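/- Let $\ell^2$ be the space of real square-summable sequences indexed by $n\ge 1$ and let $H=\mathbb{R}\times \ell^2\times \ell^2$ be the Hilbert space with norm $\|(x,u,v)\|_H^2=|x|^2+\|u\|_{\ell^2}^2+\|v\|_{\ell^2}^2$. Let $(a_n)_{n\ge1}$ be a sequence with $a_n>0$ for all $n$ and $(a_n)_n\in O^5$, i.e. $\sum_{n\ge1}(1+n^2)^5a_n^2<\infty$ (in the application, the cosine Fourier coefficients of an even $2\pi$-periodic function $f\sim\frac{a_0}{2}+\sum_{n\ge1}a_n\cos(nx)$), and define $F:H\to H$ by $$F(x,u,v)=\Big(\big\langle (a_n^{1/2}n\sin(nx))_n,u\big\rangle_{\ell^2}+\big\langle (a_n^{1/2}n\cos(nx))_n,v\big\rangle_{\ell^2},\ (a_n^{1/2}\cos(nx))_n,\ -(a_n^{1/2}\sin(nx))_n\Big).$$ Let $(\Omega,\mathcal F,(\mathcal F_t)_{t\ge0},\mathbb{P})$ be a filtered probability space such that $\mathcal F_0$ contains all $\mathbb{P}$-null sets, let $W$ be a cylindrical Wiener process on $H$ relative to $(\mathcal F_t)$, and let $\sigma:H\to H$, $\sigma(x,u,v)=(x,0,0)$,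 be the projection onto the first coordinate. Thus $\sigma W_t=(\beta_t,0,0)$, where $\beta_t=W_t(1,0,0)$ is a standard real $(\mathcal F_t)$-Brownian motion. Then $F$ is Lipschitz continuous on every ball of $H$, and for every $y\in H$ the equation $$dY_t=F(Y_t)\,dt+\sigma\,dW_t,\qquad Y_0=y,$$ has an analytically strong solution $Y\in C([0,\infty);H)\cap L^\infty_{loc}(0,\infty;H)$, that is, an $(\mathcal F_t)$-adapted $H$-valued process almost all of whose paths lie in this space and such that, almost surely, $Y_t=y+\int_0^tF(Y_s)\,ds+\sigma W_t$ in $H$ for all $t\ge0$. This solution is unique: any two such solutions $Y,Y'$ satisfy $\mathbb{P}(Y_t=Y'_t\text{ for all }t\ge0)=1$. Moreover, for every $T<\infty$, $$\mathbb{E}\Big(\sup_{t\in[0,T]}\|Y_t\|_H^2\Big)<\infty .$$ -/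

import Mathlib

open MeasureTheory ProbabilityTheory
open scoped NNReal ENNReal RealInnerProductSpace

noncomputable section

namespace SelfRepelling

/-- The Hilbert space `ℓ²` of real square summable sequences indexed by `n ≥ 1`. -/
abbrev SeqL2 : Type := lp (fun _ : ℕ+ => ℝ) 2

/-- The Hilbert space `H = ℝ × ℓ² × ℓ²`, with
`‖(x, u, v)‖² = |x|² + ‖u‖² + ‖v‖²`. -/
abbrev StateSpace : Type := WithLp 2 (ℝ × WithLp 2 (SeqL2 × SeqL2))

/-- The space `O^k` of sequences with `∑_{n ≥ 1} (1 + n²)^k a_n² < ∞`. -/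
def rapidlyDecreasing (k : ℕ) : Set (ℕ+ → ℝ) :=
  {a | Summable fun n : ℕ+ => (1 + (n : ℝ) ^ 2) ^ k * a n ^ 2}

/-- If `a ∈ O^5` and `|c_n| ≤ n`, then `(a_n^{1/2} c_n)_n` is square summable. -/
theorem memlp_sqrt_mul {a : ℕ+ → ℝ} (ha : a ∈ rapidlyDecreasing 5) {c : ℕ+ → ℝ}
    (hc : ∀ n : ℕ+, |c n| ≤ n) :
    Memℓp (E := fun _ : ℕ+ => ℝ) (fun n => √(a n) * c n) 2 := by
  have ha' : Summable fun n : ℕ+ => (1 + (n : ℝ) ^ 2) ^ 5 * a n ^ 2 := ha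
  have h2 : Summable fun n : ℕ+ => 1 / (n : ℝ) ^ 2 :=
    (Real.summable_one_div_nat_pow.mpr one_lt_two).comp_injective PNat.coe_injective
  apply memℓp_gen
  simp only [ENNReal.toReal_ofNat, Real.norm_eq_abs]
  refine Summable.of_nonneg_of_le (fun n => by positivity) (fun n => ?_) (ha'.add h2)
  have hn : (1 : ℝ) ≤ n := by exact_mod_cast n.pos
  have h0 : (0 : ℝ) < n := by linarith
  have hs : √(a n) ^ 2 ≤ |a n| := by
    rcases le_total 0 (a n) with h | h
    · rw [Real.sq_sqrt h, abs_of_nonneg h]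
    · rw [Real.sqrt_eq_zero_of_nonpos h]; simp
  have hcn : c n ^ 2 ≤ (n : ℝ) ^ 2 := by
    rw [← sq_abs]; exact pow_le_pow_left₀ (abs_nonneg _) (hc n) 2
  have h3 : |√(a n) * c n| ^ (2 : ℝ) ≤ |a n| * (n : ℝ) ^ 2 := by
    rw [Real.rpow_two, sq_abs, mul_pow]
    exact mul_le_mul hs hcn (by positivity) (by positivity)
  have h4 : |a n| * (n : ℝ) ^ 2 ≤ (|a n| * (n : ℝ) ^ 3) ^ 2 + 1 / (n : ℝ) ^ 2 := by
    have e : |a n| * (n : ℝ) ^ 2 = (|a n| * (n : ℝ) ^ 3) * (1 / n) := by field_simp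
    have e2 : 1 / (n : ℝ) ^ 2 = (1 / (n : ℝ)) ^ 2 := by rw [one_div_pow]
    rw [e, e2]
    nlinarith [sq_nonneg (|a n| * (n : ℝ) ^ 3 - 1 / n), sq_nonneg (|a n| * (n : ℝ) ^ 3),
      sq_nonneg (1 / (n : ℝ))]
  have h5 : (|a n| * (n : ℝ) ^ 3) ^ 2 ≤ (1 + (n : ℝ) ^ 2) ^ 5 * a n ^ 2 := by
    have e : (|a n| * (n : ℝ) ^ 3) ^ 2 = ((n : ℝ) ^ 2) ^ 3 * a n ^ 2 := by
      rw [mul_pow, sq_abs]; ring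
    rw [e]
    refine mul_le_mul_of_nonneg_right ?_ (sq_nonneg _)
    calc ((n : ℝ) ^ 2) ^ 3 ≤ (1 + (n : ℝ) ^ 2) ^ 3 := by gcongr; linarith
      _ ≤ (1 + (n : ℝ) ^ 2) ^ 5 :=
        pow_le_pow_right₀ (by nlinarith [sq_nonneg (n : ℝ)]) (by norm_num)
  linarith

/-- The element `(a_n^{1/2} c_n)_n` of `ℓ²`. -/
def weightedSeq (a : ℕ+ → ℝ) (ha : a ∈ rapidlyDecreasing 5) (c : ℕ+ → ℝ)
    (hc : ∀ n : ℕ+, |c n| ≤ n) : SeqL2 :=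
  ⟨fun n => √(a n) * c n, memlp_sqrt_mul ha hc⟩

theorem abs_le_of_abs_le_one {r : ℝ} (h : |r| ≤ 1) (n : ℕ+) : |r| ≤ n :=
  h.trans (by exact_mod_cast n.pos)

theorem abs_mul_le_of_abs_le_one {r : ℝ} (h : |r| ≤ 1) (n : ℕ+) : |(n : ℝ) * r| ≤ n := by
  rw [abs_mul, Nat.abs_cast]
  exact mul_le_of_le_one_right (Nat.cast_nonneg _) h

/-- The drift `F : H → H`,
`F (x, u, v) = (⟨(a_n^{1/2} n sin (n x))_n, u⟩ + ⟨(a_n^{1/2} n cos (n x))_n, v⟩,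
(a_n^{1/2} cos (n x))_n, -(a_n^{1/2} sin (n x))_n)`. -/
def drift (a : ℕ+ → ℝ) (ha : a ∈ rapidlyDecreasing 5) (y : StateSpace) : StateSpace :=
  WithLp.toLp 2
    (⟪weightedSeq a ha (fun n => n * Real.sin (n * y.fst))
        (fun n => abs_mul_le_of_abs_le_one (Real.abs_sin_le_one _) n), y.snd.fst⟫ +
      ⟪weightedSeq a ha (fun n => n * Real.cos (n * y.fst))
        (fun n => abs_mul_le_of_abs_le_one (Real.abs_cos_le_one _) n), y.snd.snd⟫,
    WithLp.toLp 2
      (weightedSeq a ha (fun n => Real.cos (n * y.fst))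
        (fun n => abs_le_of_abs_le_one (Real.abs_cos_le_one _) n),
      -weightedSeq a ha (fun n => Real.sin (n * y.fst))
        (fun n => abs_le_of_abs_le_one (Real.abs_sin_le_one _) n)))

/-- A (standard) cylindrical Wiener process on a real Hilbert space `E`, relative to the
filtration `𝓕`: a family of real processes `t ↦ W t h`, almost surely linear in `h ∈ E`, adapted,
with increments after time `s` independent of `𝓕 s`, such that `t ↦ W t h` is a
real Brownian motion for every unit vector `h`. -/
structure IsCylindricalWiener {Ω : Type*} {mΩ : MeasurableSpace Ω}
    {E : Type*} [NormedAddCommGroup E] [InnerProductSpace ℝ E]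
    (𝓕 : Filtration ℝ≥0 mΩ) (μ : Measure Ω) (W : ℝ≥0 → E → Ω → ℝ) : Prop where
  linear : ∀ (t : ℝ≥0) (p q : ℝ) (h k : E),
    ∀ᵐ ω ∂μ, W t (p • h + q • k) ω = p * W t h ω + q * W t k ω
  adapted : ∀ h : E, Adapted 𝓕 (fun t => W t h)
  indep : ∀ (h : E) (s t : ℝ≥0), s ≤ t →
    Indep (MeasurableSpace.comap (fun ω => W t h ω - W s h ω) inferInstance) (𝓕 s) μ
  brownian : ∀ h : E, ‖h‖ = 1 → IsBrownianReal (fun t => W t h) μ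

/-- The unit vector `(1, 0, 0)` of `H`. -/
def e₀ : StateSpace := WithLp.toLp 2 (1, 0)

/-- The noise operator `σ : H → H`, the orthogonal projection onto the first coordinate. -/
def sigma : StateSpace →L[ℝ] StateSpace := (innerSL ℝ e₀).smulRight e₀

theorem sigma_apply (h : StateSpace) : sigma h = WithLp.toLp 2 (h.fst, 0) := by
  have h1 : ⟪e₀, h⟫ = h.fst := by simp [e₀]
  have : sigma h = ⟪e₀, h⟫ • e₀ := rfl
  rw [this, h1, e₀, ← WithLp.toLp_smul]
  simp

/-- The `H`-valued process `σ W_t = ∫_0^t σ dW_s = (W_t(e₀), 0, 0)`. -/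
def sigmaW {Ω : Type*} (W : ℝ≥0 → StateSpace → Ω → ℝ) (t : ℝ≥0) (ω : Ω) : StateSpace :=
  W t e₀ ω • e₀

/-- `sigmaW` is the `H`-valued process characterized by `⟨σ W_t, h⟩ = W_t(σ* h)`. -/
theorem inner_sigmaW {Ω : Type*} {mΩ : MeasurableSpace Ω} {𝓕 : Filtration ℝ≥0 mΩ}
    {μ : Measure Ω} {W : ℝ≥0 → StateSpace → Ω → ℝ} (hW : IsCylindricalWiener 𝓕 μ W)
    (t : ℝ≥0) (h : StateSpace) :
    ∀ᵐ ω ∂μ, ⟪sigmaW W t ω, h⟫ = W t (ContinuousLinearMap.adjoint sigma h) ω := by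
  have h1 : ContinuousLinearMap.adjoint sigma h = ⟪e₀, h⟫ • e₀ + (0 : ℝ) • e₀ := by
    refine ext_inner_left ℝ fun k => ?_
    rw [ContinuousLinearMap.adjoint_inner_right]
    have : sigma k = ⟪e₀, k⟫ • e₀ := rfl
    rw [this, zero_smul, add_zero, real_inner_smul_left, real_inner_smul_right,
      real_inner_comm k e₀, mul_comm]
  filter_upwards [hW.linear t ⟪e₀, h⟫ 0 e₀ e₀] with ω hω
  rw [h1, hω, sigmaW, real_inner_smul_left]
  ring

/-- `Y` is an (analytically) strong solution in `C([0,∞); H) ∩ L^∞_loc(0,∞; H)` of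
`dY = F(Y) dt + σ dW`, `Y_0 = y`: an `𝓕`-adapted `H`-valued process, almost all of whose paths are
continuous on `[0,∞)`, locally `L^∞` on `(0,∞)`, and satisfy
`Y_t = y + ∫_0^t F(Y_s) ds + σ W_t` for all `t ≥ 0`, as an identity in `H` with a Bochner
integral. -/
structure IsStrongSolution {Ω : Type*} {mΩ : MeasurableSpace Ω} (𝓕 : Filtration ℝ≥0 mΩ)
    (μ : Measure Ω) (F : StateSpace → StateSpace) (W : ℝ≥0 → StateSpace → Ω → ℝ)
    (y : StateSpace) (Y : ℝ≥0 → Ω → StateSpace) : Prop where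
  adapted : StronglyAdapted 𝓕 Y
  continuous : ∀ᵐ ω ∂μ, Continuous fun t => Y t ω
  locallyBounded : ∀ᵐ ω ∂μ, ∀ K : Set ℝ, IsCompact K → K ⊆ Set.Ioi 0 →
    MemLp (fun s : ℝ => Y s.toNNReal ω) ⊤ (volume.restrict K)
  integrable : ∀ᵐ ω ∂μ, ∀ t : ℝ≥0,
    IntervalIntegrable (fun s : ℝ => F (Y s.toNNReal ω)) volume 0 t
  equation : ∀ᵐ ω ∂μ, ∀ t : ℝ≥0,
    Y t ω = y + (∫ s in (0 : ℝ)..t, F (Y s.toNNReal ω)) + sigmaW W t ω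

end SelfRepelling

end

/-! The drift has two features that replace global Lipschitz continuity. Its `(u, v)`-component is
bounded, and the noise acts only on `x`; hence on `[0, T]` every solution and every Picard iterate
has `(u, v)` bounded by a deterministic constant. And `F` is Lipschitz on each set where `(u, v)` is
bounded, whatever `x` is, because `x` enters only through sines and cosines
(`exists_lipschitzOnWith_drift`).

As the noise is additive, the equation can be solved path by path: for a fixed continuous path `w t
= y + β t • e₀` it is a deterministic integral equation. Picard iteration never leaves a set on
which `F` is Lipschitz, so it converges locally uniformly (`exists_tendsto_picardIterate`). The
iterates are adapted, hence so is their limit. Uniqueness is Gronwall's inequality for the integral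
part of the solution (`eq_of_integral_equation`).

For the moment bound, `F` has linear growth in `(u, v)` alone, so `‖Y t‖ ≤ D + |β t|` on `[0, T]`
with `D` deterministic. It remains to dominate `sup |β t|²` by an integrable variable, which comes
from dyadic chaining with Gaussian fourth moments (`exists_dominating_of_isBrownianReal`). -/

namespace SelfRepelling

/-! ### Lipschitz and growth estimates for the drift -/

section Drift

/-- If `a ∈ O^5`, then `(a_n^{1/2} n²)_n` is square summable. -/
theorem memlp_sqrt_mul_sq {a : ℕ+ → ℝ} (ha : a ∈ rapidlyDecreasing 5) :
    Memℓp (E := fun _ : ℕ+ => ℝ) (fun n => √(a n) * (n : ℝ) ^ 2) 2 := by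
  have ha' : Summable fun n : ℕ+ => (1 + (n : ℝ) ^ 2) ^ 5 * a n ^ 2 := ha
  have h2 : Summable fun n : ℕ+ => 1 / (n : ℝ) ^ 2 :=
    (Real.summable_one_div_nat_pow.mpr one_lt_two).comp_injective PNat.coe_injective
  apply memℓp_gen
  simp only [ENNReal.toReal_ofNat, Real.norm_eq_abs]
  refine Summable.of_nonneg_of_le (fun n => by positivity) (fun n => ?_) (ha'.add h2)
  have h0 : (0 : ℝ) < n := by exact_mod_cast n.pos
  have hs : √(a n) ^ 2 ≤ |a n| := by
    rcases le_total 0 (a n) with h | h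
    · rw [Real.sq_sqrt h, abs_of_nonneg h]
    · rw [Real.sqrt_eq_zero_of_nonpos h]; simp
  have h3 : |√(a n) * (n : ℝ) ^ 2| ^ (2 : ℝ) ≤ |a n| * (n : ℝ) ^ 4 := by
    rw [Real.rpow_two, sq_abs, mul_pow, ← pow_mul]
    exact mul_le_mul_of_nonneg_right hs (by positivity)
  -- Split off a factor `1 / n`, so that the product is at most a sum of two summable squares; this
  -- is where the weight exponent 5 is used up.
  have h4 : |a n| * (n : ℝ) ^ 4 ≤ (|a n| * (n : ℝ) ^ 5) ^ 2 + 1 / (n : ℝ) ^ 2 := by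
    have e : |a n| * (n : ℝ) ^ 4 = (|a n| * (n : ℝ) ^ 5) * (1 / n) := by field_simp
    have e2 : 1 / (n : ℝ) ^ 2 = (1 / (n : ℝ)) ^ 2 := by rw [one_div_pow]
    rw [e, e2]
    nlinarith [sq_nonneg (|a n| * (n : ℝ) ^ 5 - 1 / n), sq_nonneg (|a n| * (n : ℝ) ^ 5),
      sq_nonneg (1 / (n : ℝ))]
  have h5 : (|a n| * (n : ℝ) ^ 5) ^ 2 ≤ (1 + (n : ℝ) ^ 2) ^ 5 * a n ^ 2 := by
    have e : (|a n| * (n : ℝ) ^ 5) ^ 2 = ((n : ℝ) ^ 2) ^ 5 * a n ^ 2 := by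
      rw [mul_pow, sq_abs]; ring
    rw [e]
    refine mul_le_mul_of_nonneg_right ?_ (sq_nonneg _)
    gcongr
    linarith
  linarith

/-- The element `(a_n^{1/2} n²)_n` of `ℓ²`. -/
noncomputable def sqWeightedSeq (a : ℕ+ → ℝ) (ha : a ∈ rapidlyDecreasing 5) : SeqL2 :=
  ⟨fun n => √(a n) * (n : ℝ) ^ 2, memlp_sqrt_mul_sq ha⟩

variable {a : ℕ+ → ℝ} {ha : a ∈ rapidlyDecreasing 5}

theorem norm_le_mul_norm_of_forall_abs_le {f g : SeqL2} {d : ℝ} (hd : 0 ≤ d)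
    (h : ∀ n, |f n| ≤ d * |g n|) : ‖f‖ ≤ d * ‖g‖ := by
  have hs : ∀ f : SeqL2, ‖f‖ ^ 2 = ∑' n, |f n| ^ 2 ∧ Summable fun n => |f n| ^ 2 := fun f => by
    have h1 := lp.norm_rpow_eq_tsum (p := 2) (by norm_num) f
    have h2 := (lp.memℓp f).summable (by norm_num)
    simp only [ENNReal.toReal_ofNat, Real.rpow_two, Real.norm_eq_abs] at h1 h2
    exact ⟨h1, h2⟩
  refine (pow_le_pow_iff_left₀ (norm_nonneg _) ?_ two_ne_zero).1 ?_
  · positivity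
  rw [mul_pow, (hs f).1, (hs g).1, ← tsum_mul_left]
  refine (hs f).2.tsum_le_tsum (fun n => ?_) ((hs g).2.mul_left _)
  rw [← mul_pow]
  exact pow_le_pow_left₀ (abs_nonneg _) (h n) 2

theorem norm_weightedSeq_le {c : ℕ+ → ℝ} (hc : ∀ n : ℕ+, |c n| ≤ n) :
    ‖weightedSeq a ha c hc‖ ≤ ‖sqWeightedSeq a ha‖ := by
  rw [← one_mul ‖sqWeightedSeq a ha‖]
  refine norm_le_mul_norm_of_forall_abs_le zero_le_one fun n => ?_
  change |√(a n) * c n| ≤ 1 * |√(a n) * (n : ℝ) ^ 2|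
  have hn : (1 : ℝ) ≤ n := by exact_mod_cast n.pos
  rw [one_mul, abs_mul, abs_mul]
  refine mul_le_mul_of_nonneg_left ((hc n).trans ?_) (abs_nonneg _)
  rw [abs_of_nonneg (by positivity)]
  nlinarith

/-- The weight `n ^ 2` suits the first drift component: one factor `n` is present in its
coefficients, the other comes from differentiating `sin (n x)` or `cos (n x)`. -/
theorem norm_weightedSeq_sub_le {c c' : ℕ+ → ℝ} (hc : ∀ n : ℕ+, |c n| ≤ n)
    (hc' : ∀ n : ℕ+, |c' n| ≤ n) {d : ℝ} (hd : 0 ≤ d)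
    (h : ∀ n : ℕ+, |c n - c' n| ≤ d * (n : ℝ) ^ 2) :
    ‖weightedSeq a ha c hc - weightedSeq a ha c' hc'‖ ≤ d * ‖sqWeightedSeq a ha‖ := by
  refine norm_le_mul_norm_of_forall_abs_le hd fun n => ?_
  change |√(a n) * c n - √(a n) * c' n| ≤ d * |√(a n) * (n : ℝ) ^ 2|
  rw [← mul_sub, abs_mul, abs_mul, mul_left_comm, abs_of_nonneg (sq_nonneg (n : ℝ))]
  exact mul_le_mul_of_nonneg_left (h n) (abs_nonneg _)

theorem abs_sin_mul_sub_le (n : ℕ+) (x x' : ℝ) :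
    |Real.sin (n * x) - Real.sin (n * x')| ≤ n * |x - x'| := by
  have := Real.lipschitzWith_sin.dist_le_mul (n * x) (n * x')
  simpa [Real.dist_eq, ← mul_sub, abs_mul] using this

theorem abs_cos_mul_sub_le (n : ℕ+) (x x' : ℝ) :
    |Real.cos (n * x) - Real.cos (n * x')| ≤ n * |x - x'| := by
  have := Real.lipschitzWith_cos.dist_le_mul (n * x) (n * x')
  simpa [Real.dist_eq, ← mul_sub, abs_mul] using this

theorem le_mul_sq_of_le {r d : ℝ} (hd : 0 ≤ d) (n : ℕ+) (h : r ≤ n * d) :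
    r ≤ d * (n : ℝ) ^ 2 := by
  have hn : (1 : ℝ) ≤ n := by exact_mod_cast n.pos
  nlinarith [mul_le_mul_of_nonneg_left hn (mul_nonneg hd (zero_le_one.trans hn))]

theorem abs_mul_sub_mul_le {r r' d : ℝ} (n : ℕ+) (h : |r - r'| ≤ n * d) :
    |n * r - n * r'| ≤ d * (n : ℝ) ^ 2 := by
  rw [← mul_sub, abs_mul, Nat.abs_cast]
  nlinarith [mul_le_mul_of_nonneg_left h (Nat.cast_nonneg (α := ℝ) n)]

theorem norm_toLp_prod_le {E F : Type*} [SeminormedAddCommGroup E] [SeminormedAddCommGroup F]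
    (x : E) (y : F) : ‖WithLp.toLp 2 (x, y)‖ ≤ ‖x‖ + ‖y‖ := by
  rw [WithLp.prod_norm_eq_of_L2]
  exact Real.sqrt_le_iff.2 ⟨by positivity, by simp; nlinarith [norm_nonneg x, norm_nonneg y]⟩

theorem norm_fst_le {E F : Type*} [SeminormedAddCommGroup E] [SeminormedAddCommGroup F]
    (z : WithLp 2 (E × F)) : ‖z.fst‖ ≤ ‖z‖ := by
  rw [WithLp.prod_norm_eq_of_L2]
  exact Real.le_sqrt_of_sq_le (by nlinarith [norm_nonneg z.snd])

theorem norm_snd_le {E F : Type*} [SeminormedAddCommGroup E] [SeminormedAddCommGroup F]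
    (z : WithLp 2 (E × F)) : ‖z.snd‖ ≤ ‖z‖ := by
  rw [WithLp.prod_norm_eq_of_L2]
  exact Real.le_sqrt_of_sq_le (by nlinarith [norm_nonneg z.fst])

theorem norm_drift_snd_le (y : StateSpace) :
    ‖(drift a ha y).snd‖ ≤ 2 * ‖sqWeightedSeq a ha‖ := by
  refine (norm_toLp_prod_le _ _).trans ?_
  rw [norm_neg, two_mul]
  exact add_le_add (norm_weightedSeq_le _) (norm_weightedSeq_le _)

/-- Only the two inner products are unbounded, and they are linear in `(u, v)` with coefficients
bounded uniformly in `x`. -/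
theorem norm_drift_le (y : StateSpace) :
    ‖drift a ha y‖ ≤ 2 * ‖sqWeightedSeq a ha‖ * (1 + ‖y.snd‖) := by
  refine (norm_toLp_prod_le (drift a ha y).fst (drift a ha y).snd).trans ?_
  have h1 : ‖(drift a ha y).fst‖ ≤
      ‖sqWeightedSeq a ha‖ * ‖y.snd‖ + ‖sqWeightedSeq a ha‖ * ‖y.snd‖ :=
    (norm_add_le _ _).trans (add_le_add
      ((norm_inner_le_norm _ _).trans (mul_le_mul (norm_weightedSeq_le _) (norm_fst_le _)
        (norm_nonneg _) (norm_nonneg _)))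
      ((norm_inner_le_norm _ _).trans (mul_le_mul (norm_weightedSeq_le _) (norm_snd_le _)
        (norm_nonneg _) (norm_nonneg _))))
  linarith [norm_drift_snd_le (ha := ha) y]

theorem abs_inner_sub_inner_le {E : Type*} [NormedAddCommGroup E] [InnerProductSpace ℝ E]
    (p p' u u' : E) : |⟪p, u⟫ - ⟪p', u'⟫| ≤ ‖p - p'‖ * ‖u‖ + ‖p'‖ * ‖u - u'‖ := by
  have : ⟪p, u⟫ - ⟪p', u'⟫ = ⟪p - p', u⟫ + ⟪p', u - u'⟫ := by
    rw [inner_sub_left, inner_sub_right]; ring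
  rw [this]
  exact (abs_add_le _ _).trans
    (add_le_add (abs_real_inner_le_norm _ _) (abs_real_inner_le_norm _ _))

/-- The drift is Lipschitz on the sets on which `(u, v)` is bounded. -/
theorem exists_lipschitzOnWith_drift (R : ℝ) : ∃ K : ℝ≥0,
    LipschitzOnWith K (drift a ha) {y | ‖y.snd‖ ≤ R} := by
  set B := ‖sqWeightedSeq a ha‖
  have hB0 : 0 ≤ B := norm_nonneg _
  -- The first component contributes `2 * B * (1 + max R 0)` and the other two contribute `B` each.
  -- The maximum covers negative `R`.
  refine ⟨(2 * B * (2 + max R 0)).toNNReal, LipschitzOnWith.of_dist_le_mul ?_⟩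
  intro y hy y' hy'
  rw [Real.coe_toNNReal _ (by positivity), dist_eq_norm, dist_eq_norm]
  have hR : ‖y.snd‖ ≤ max R 0 := le_max_of_le_left hy
  have hx : |y.fst - y'.fst| ≤ ‖y - y'‖ := norm_fst_le (y - y')
  have hu : ‖y.snd.fst - y'.snd.fst‖ ≤ ‖y - y'‖ :=
    (norm_fst_le (y - y').snd).trans (norm_snd_le _)
  have hv : ‖y.snd.snd - y'.snd.snd‖ ≤ ‖y - y'‖ :=
    (norm_snd_le (y - y').snd).trans (norm_snd_le _)
  have hu0 : ‖y.snd.fst‖ ≤ max R 0 := (norm_fst_le _).trans hR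
  have hv0 : ‖y.snd.snd‖ ≤ max R 0 := (norm_snd_le _).trans hR
  have hd := abs_nonneg (y.fst - y'.fst)
  have key : ∀ {c c' : ℕ+ → ℝ} (hc : ∀ n : ℕ+, |c n| ≤ n) (hc' : ∀ n : ℕ+, |c' n| ≤ n),
      (∀ n : ℕ+, |c n - c' n| ≤ |y.fst - y'.fst| * (n : ℝ) ^ 2) →
      ‖weightedSeq a ha c hc - weightedSeq a ha c' hc'‖ ≤ ‖y - y'‖ * B := fun hc hc' h =>
    (norm_weightedSeq_sub_le hc hc' hd h).trans (mul_le_mul_of_nonneg_right hx hB0)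
  have key2 : ∀ {c c' : ℕ+ → ℝ} (hc : ∀ n : ℕ+, |c n| ≤ n) (hc' : ∀ n : ℕ+, |c' n| ≤ n)
      (_ : ∀ n : ℕ+, |c n - c' n| ≤ |y.fst - y'.fst| * (n : ℝ) ^ 2) (u u' : SeqL2)
      (_ : ‖u‖ ≤ max R 0) (_ : ‖u - u'‖ ≤ ‖y - y'‖),
      |⟪weightedSeq a ha c hc, u⟫ - ⟪weightedSeq a ha c' hc', u'⟫| ≤
        B * (1 + max R 0) * ‖y - y'‖ := fun hc hc' h u u' h1 h2 => by
    refine (abs_inner_sub_inner_le _ _ _ _).trans ?_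
    have e1 := mul_le_mul (key hc hc' h) h1 (norm_nonneg _) (by positivity)
    have e2 := mul_le_mul (norm_weightedSeq_le (ha := ha) hc') h2 (norm_nonneg _) hB0
    linarith
  have h1 : ‖(drift a ha y - drift a ha y').fst‖ ≤ 2 * (B * (1 + max R 0) * ‖y - y'‖) := by
    have e1 := key2 (fun n => abs_mul_le_of_abs_le_one (Real.abs_sin_le_one (n * y.fst)) n)
      (fun n => abs_mul_le_of_abs_le_one (Real.abs_sin_le_one (n * y'.fst)) n)
      (fun n => abs_mul_sub_mul_le n (abs_sin_mul_sub_le n _ _)) _ _ hu0 hu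
    have e2 := key2 (fun n => abs_mul_le_of_abs_le_one (Real.abs_cos_le_one (n * y.fst)) n)
      (fun n => abs_mul_le_of_abs_le_one (Real.abs_cos_le_one (n * y'.fst)) n)
      (fun n => abs_mul_sub_mul_le n (abs_cos_mul_sub_le n _ _)) _ _ hv0 hv
    rw [two_mul]
    refine le_trans (le_of_eq (congrArg abs ?_)) ((abs_add_le _ _).trans (add_le_add e1 e2))
    exact add_sub_add_comm _ _ _ _
  have h2 : ‖(drift a ha y - drift a ha y').snd‖ ≤ ‖y - y'‖ * B + ‖y - y'‖ * B := by
    refine (norm_toLp_prod_le (drift a ha y - drift a ha y').snd.fst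
      (drift a ha y - drift a ha y').snd.snd).trans (add_le_add ?_ ?_)
    · exact key (fun n => abs_le_of_abs_le_one (Real.abs_cos_le_one _) n)
        (fun n => abs_le_of_abs_le_one (Real.abs_cos_le_one _) n)
        fun n => le_mul_sq_of_le hd n (abs_cos_mul_sub_le n _ _)
    · rw [← norm_neg]
      refine le_trans (le_of_eq (congrArg norm ?_))
        (key (fun n => abs_le_of_abs_le_one (Real.abs_sin_le_one _) n)
          (fun n => abs_le_of_abs_le_one (Real.abs_sin_le_one _) n)
          fun n => le_mul_sq_of_le hd n (abs_sin_mul_sub_le n _ _))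
      exact (neg_sub' _ _).trans (congrArg₂ _ (neg_neg _) (neg_neg _))
  refine (norm_toLp_prod_le (drift a ha y - drift a ha y').fst
    (drift a ha y - drift a ha y').snd).trans ?_
  linarith

end Drift

end SelfRepelling

namespace SelfRepelling

/-! ### Pathwise integral equation: Picard iteration, uniqueness, adaptedness -/

section IntegralEquation

open Set Filter Topology

variable {E G : Type*} [NormedAddCommGroup E] [NormedSpace ℝ E]
  [NormedAddCommGroup G] [NormedSpace ℝ G]

/-- The Picard iterates of the integral equation `y t = w t + ∫_0^t F (y s) ds`. -/
noncomputable def picardIterate (F : E → E) (w : ℝ≥0 → E) : ℕ → ℝ≥0 → E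
  | 0 => w
  | k + 1 => fun t => w t + ∫ s in (0 : ℝ)..t, F (picardIterate F w k s.toNNReal)

variable {F : E → E} {w : ℝ≥0 → E}

theorem continuous_integral_toNNReal {f : ℝ≥0 → E} (hf : Continuous f) :
    Continuous fun t : ℝ≥0 => ∫ s in (0 : ℝ)..t, f s.toNNReal :=
  (intervalIntegral.continuous_primitive
    (fun _ _ => (hf.comp continuous_real_toNNReal).intervalIntegrable _ _) 0).comp
    NNReal.continuous_coe

theorem continuous_picardIterate (hF : Continuous F) (hw : Continuous w) (k : ℕ) :
    Continuous (picardIterate F w k) := by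
  induction k with
  | zero => exact hw
  | succ k ih => exact hw.add (continuous_integral_toNNReal (hF.comp ih))

theorem norm_integral_toNNReal_le {f : ℝ≥0 → E} {C : ℝ} {t : ℝ≥0} (h : ∀ s ≤ t, ‖f s‖ ≤ C) :
    ‖∫ s in (0 : ℝ)..t, f s.toNNReal‖ ≤ C * t := by
  refine (intervalIntegral.norm_integral_le_of_norm_le_const (C := C) fun s hs => ?_).trans ?_
  · rw [uIoc_of_le t.coe_nonneg] at hs
    exact h _ (Real.toNNReal_le_iff_le_coe.2 hs.2)
  · rw [sub_zero, NNReal.abs_eq]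

variable {p : E →L[ℝ] G} {A : ℝ} {c : G}

theorem map_integral_toNNReal [CompleteSpace E] [CompleteSpace G] {f : ℝ≥0 → E}
    (hf : Continuous f) (t : ℝ≥0) :
    p (∫ s in (0 : ℝ)..t, f s.toNNReal) = ∫ s in (0 : ℝ)..t, p (f s.toNNReal) :=
  (p.intervalIntegral_comp_comm
    ((hf.comp continuous_real_toNNReal).intervalIntegrable _ _)).symm

/-- A solution of the integral equation, or a Picard iterate, is bounded in the directions in which
the drift is bounded and the noise is constant. -/
theorem norm_map_add_integral_le [CompleteSpace E] [CompleteSpace G] {f : ℝ≥0 → E}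
    (hF : Continuous F) (hf : Continuous f) (hA : ∀ y, ‖p (F y)‖ ≤ A) (hp : ∀ t, p (w t) = c)
    (t : ℝ≥0) : ‖p (w t + ∫ s in (0 : ℝ)..t, F (f s.toNNReal))‖ ≤ ‖c‖ + A * t := by
  rw [map_add, hp, map_integral_toNNReal (f := fun s => F (f s)) (hF.comp hf)]
  exact (norm_add_le _ _).trans (by
    gcongr; exact norm_integral_toNNReal_le (f := fun s => p (F (f s))) fun s _ => hA _)

theorem norm_map_picardIterate_le [CompleteSpace E] [CompleteSpace G]
    (hF : Continuous F) (hw : Continuous w) (hA : ∀ y, ‖p (F y)‖ ≤ A) (hp : ∀ t, p (w t) = c)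
    (k : ℕ) (t : ℝ≥0) : ‖p (picardIterate F w k t)‖ ≤ ‖c‖ + A * t := by
  cases k with
  | zero =>
    have hA0 : 0 ≤ A := (norm_nonneg _).trans (hA 0)
    simp only [picardIterate, hp]
    exact le_add_of_nonneg_right (by positivity)
  | succ k => exact norm_map_add_integral_le hF (continuous_picardIterate hF hw k) hA hp t

/-- All iterates stay in `S`, so each step costs a factor `K` and one integration in time;
integrating `s ^ k` builds up the factorial. -/
theorem norm_picardIterate_succ_sub_le (hF : Continuous F) (hw : Continuous w) {K M : ℝ≥0}
    {S : Set E} {T : ℝ≥0} (hK : LipschitzOnWith K F S)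
    (hS : ∀ k, ∀ t ≤ T, picardIterate F w k t ∈ S)
    (hM : ∀ t ≤ T, ‖∫ s in (0 : ℝ)..t, F (w s.toNNReal)‖ ≤ M) (k : ℕ) :
    ∀ t ≤ T, ‖picardIterate F w (k + 1) t - picardIterate F w k t‖ ≤
      M * ((K * t) ^ k / k.factorial) := by
  induction k with
  | zero => intro t ht; simpa [picardIterate] using hM t ht
  | succ k ih =>
    intro t ht
    have hc : ∀ k, Continuous fun s : ℝ => F (picardIterate F w k s.toNNReal) := fun k =>
      hF.comp ((continuous_picardIterate hF hw k).comp continuous_real_toNNReal)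
    have e : picardIterate F w (k + 1 + 1) t - picardIterate F w (k + 1) t =
        ∫ s in (0 : ℝ)..t, (F (picardIterate F w (k + 1) s.toNNReal) -
          F (picardIterate F w k s.toNNReal)) := by
      rw [intervalIntegral.integral_sub ((hc _).intervalIntegrable _ _)
        ((hc _).intervalIntegrable _ _)]
      simp only [picardIterate, add_sub_add_left_eq_sub]
    rw [e]
    have hle : ∀ s ∈ Ioc (0 : ℝ) t, ‖F (picardIterate F w (k + 1) s.toNNReal) -
        F (picardIterate F w k s.toNNReal)‖ ≤ K * (M * ((K * s) ^ k / k.factorial)) := by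
      intro s hs
      have hsT : s.toNNReal ≤ T := (Real.toNNReal_le_iff_le_coe.2 hs.2).trans ht
      have h1 := hK.norm_sub_le (hS (k + 1) _ hsT) (hS k _ hsT)
      have h2 := ih _ hsT
      rw [Real.coe_toNNReal _ hs.1.le] at h2
      exact h1.trans (by gcongr)
    refine (intervalIntegral.norm_integral_le_of_norm_le t.coe_nonneg
      (Filter.Eventually.of_forall hle)
      (Continuous.intervalIntegrable (by fun_prop) _ _)).trans (le_of_eq ?_)
    have e2 : ∀ s : ℝ, (K : ℝ) * (M * ((K * s) ^ k / k.factorial)) =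
        (K * M * K ^ k / k.factorial) * s ^ k := fun s => by rw [mul_pow]; ring
    simp only [e2]
    rw [intervalIntegral.integral_const_mul, integral_pow, Nat.factorial_succ]
    push_cast
    field_simp
    ring

/-- Solvability of the integral equation by Picard iteration, when the drift is Lipschitz on sets
which the iterates do not leave. -/
theorem exists_tendsto_picardIterate [CompleteSpace E] [CompleteSpace G] (hF : Continuous F)
    (hLip : ∀ R : ℝ, ∃ K : ℝ≥0, LipschitzOnWith K F {y | ‖p y‖ ≤ R})
    (hA : ∀ y, ‖p (F y)‖ ≤ A) (hw : Continuous w) (hp : ∀ t, p (w t) = c) :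
    ∃ y : ℝ≥0 → E, Continuous y ∧
      (∀ t, Tendsto (fun k => picardIterate F w k t) atTop (𝓝 (y t))) ∧
      ∀ t : ℝ≥0, y t = w t + ∫ s in (0 : ℝ)..t, F (y s.toNNReal) := by
  have hA0 : 0 ≤ A := (norm_nonneg _).trans (hA 0)
  have hest : ∀ T : ℝ≥0, ∃ (K : ℝ≥0) (d : ℕ → ℝ),
      LipschitzOnWith K F {y | ‖p y‖ ≤ ‖c‖ + A * T} ∧ Summable d ∧ ∀ k, ∀ t ≤ T,
      dist (picardIterate F w k t) (picardIterate F w (k + 1) t) ≤ d k := by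
    intro T
    obtain ⟨K, hK⟩ := hLip (‖c‖ + A * T)
    obtain ⟨M, hM⟩ := (isCompact_Icc (a := (0 : ℝ≥0)) (b := T)).exists_bound_of_continuousOn
      (continuous_integral_toNNReal (hF.comp hw)).continuousOn
    refine ⟨K, fun k => M.toNNReal * ((K * T) ^ k / k.factorial), hK,
      (Real.summable_pow_div_factorial _).mul_left _, fun k t ht => ?_⟩
    rw [dist_comm, dist_eq_norm]
    refine (norm_picardIterate_succ_sub_le (M := M.toNNReal) hF hw hK (fun k s hs => ?_)
      (fun s hs => (hM s ⟨zero_le, hs⟩).trans (Real.le_coe_toNNReal M)) k t ht).trans ?_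
    · exact (norm_map_picardIterate_le hF hw hA hp k s).trans (by gcongr)
    · change _ ≤ (M.toNNReal : ℝ) * ((K * T) ^ k / k.factorial)
      gcongr
  have hlim : ∀ t, ∃ z, Tendsto (fun k => picardIterate F w k t) atTop (𝓝 z) := fun t => by
    obtain ⟨K, d, -, hd, h⟩ := hest t
    exact cauchySeq_tendsto_of_complete
      (cauchySeq_of_dist_le_of_summable d (fun k => h k t le_rfl) hd)
  choose y hy using hlim
  have hunif : ∀ T : ℝ≥0, ∃ r : ℕ → ℝ, Tendsto r atTop (𝓝 0) ∧
      ∀ k, ∀ t ≤ T, dist (picardIterate F w k t) (y t) ≤ r k := fun T => by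
    obtain ⟨K, d, -, hd, h⟩ := hest T
    exact ⟨_, tendsto_sum_nat_add d, fun k t ht => by
      simpa only [add_comm] using
        dist_le_tsum_of_dist_le_of_tendsto d (fun k => h k t ht) hd (hy t) k⟩
  have hcont : Continuous y := by
    rw [continuous_iff_continuousAt]
    intro t
    obtain ⟨r, hr, h⟩ := hunif (t + 1)
    -- Uniform convergence up to `t + 1` covers a neighbourhood of `t`, which gives continuity at
    -- `t`.
    have hu : TendstoUniformlyOn (picardIterate F w) y atTop (Iic (t + 1)) := by
      rw [Metric.tendstoUniformlyOn_iff]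
      intro ε hε
      filter_upwards [hr.eventually (gt_mem_nhds hε)] with k hk s hs
      rw [dist_comm]
      exact (h k s hs).trans_lt hk
    exact (hu.continuousOn (Frequently.of_forall fun k =>
      (continuous_picardIterate hF hw k).continuousOn)).continuousAt
        (Iic_mem_nhds (lt_add_one t))
  refine ⟨y, hcont, hy, fun t => ?_⟩
  obtain ⟨K, d, hK, -, -⟩ := hest t
  obtain ⟨r, hr, h⟩ := hunif t
  -- The shifted iterates also converge to the right-hand side: the integrands converge uniformly on
  -- `[0, t]`, by the Lipschitz bound on the closed set containing the iterates and their limit.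
  refine tendsto_nhds_unique ((tendsto_add_atTop_iff_nat 1).2 (hy t))
    (tendsto_const_nhds.add ?_)
  rw [tendsto_iff_norm_sub_tendsto_zero]
  have hr' : Tendsto (fun k => K * r k * t) atTop (𝓝 0) := by
    simpa using (hr.const_mul (K : ℝ)).mul_const (t : ℝ)
  refine squeeze_zero (fun _ => norm_nonneg _) (fun k => ?_) hr'
  have hmem : ∀ k, ∀ s ≤ t, picardIterate F w k s ∈ {y | ‖p y‖ ≤ ‖c‖ + A * t} := fun k s hs =>
    (norm_map_picardIterate_le hF hw hA hp k s).trans (by gcongr)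
  rw [← intervalIntegral.integral_sub]
  · refine norm_integral_toNNReal_le
      (f := fun s => F (picardIterate F w k s) - F (y s)) fun s hs => ?_
    have hys : y s ∈ {y | ‖p y‖ ≤ ‖c‖ + A * t} :=
      le_of_tendsto ((p.continuous.norm.tendsto _).comp (hy s))
        (Eventually.of_forall fun k => hmem k s hs)
    refine (hK.norm_sub_le (hmem k s hs) hys).trans ?_
    rw [← dist_eq_norm]
    exact mul_le_mul_of_nonneg_left (h k s hs) K.2
  · exact (hF.comp ((continuous_picardIterate hF hw k).comp
      continuous_real_toNNReal)).intervalIntegrable _ _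
  · exact (hF.comp (hcont.comp continuous_real_toNNReal)).intervalIntegrable _ _

/-- Since `w` need not be differentiable, ODE uniqueness is applied to the integral parts `y - w`
and `z - w`, which solve `x' = F (w s + x)`. Both solutions are bounded on `[0, t]`, so one
Lipschitz constant serves. -/
theorem eq_of_integral_equation [CompleteSpace E] (hF : Continuous F)
    (hLip : ∀ R : ℝ, ∃ K : ℝ≥0, LipschitzOnWith K F (Metric.closedBall 0 R))
    {y z : ℝ≥0 → E} (hy : Continuous y) (hz : Continuous z)
    (ey : ∀ t : ℝ≥0, y t = w t + ∫ s in (0 : ℝ)..t, F (y s.toNNReal))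
    (ez : ∀ t : ℝ≥0, z t = w t + ∫ s in (0 : ℝ)..t, F (z s.toNNReal)) (t : ℝ≥0) :
    y t = z t := by
  obtain ⟨R, hR⟩ := (isCompact_Icc (a := (0 : ℝ≥0)) (b := t)).exists_bound_of_continuousOn
    hy.continuousOn
  obtain ⟨R', hR'⟩ := (isCompact_Icc (a := (0 : ℝ≥0)) (b := t)).exists_bound_of_continuousOn
    hz.continuousOn
  obtain ⟨K, hK⟩ := hLip (max R R')
  -- Through `toNNReal` the integrand is continuous on all of `ℝ`, so the derivative is two-sided
  -- even at `s = 0`.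
  have hprim : ∀ {f : ℝ≥0 → E}, Continuous f →
      (∀ t : ℝ≥0, f t = w t + ∫ s in (0 : ℝ)..t, F (f s.toNNReal)) → ∀ s : ℝ, 0 ≤ s →
      f s.toNNReal = w s.toNNReal + (∫ r in (0 : ℝ)..s, F (f r.toNNReal)) ∧
      HasDerivAt (fun s => ∫ r in (0 : ℝ)..s, F (f r.toNNReal))
        (F (w s.toNNReal + ∫ r in (0 : ℝ)..s, F (f r.toNNReal))) s := by
    intro f hf ef s hs
    have e : f s.toNNReal = w s.toNNReal + ∫ r in (0 : ℝ)..s, F (f r.toNNReal) := by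
      simpa [Real.coe_toNNReal s hs] using ef s.toNNReal
    refine ⟨e, ?_⟩
    rw [← e]
    exact (hF.comp (hf.comp continuous_real_toNNReal)).integral_hasStrictDerivAt 0 s |>.hasDerivAt
  have hmem : ∀ s ∈ Ico (0 : ℝ) t, s.toNNReal ∈ Icc 0 t := fun s hs =>
    ⟨zero_le, Real.toNNReal_le_iff_le_coe.2 hs.2.le⟩
  have hEq := ODE_solution_unique_of_mem_Icc_right (K := K) (a := 0) (b := (t : ℝ))
    (v := fun s x => F (w s.toNNReal + x))
    (s := fun s => {x | w s.toNNReal + x ∈ Metric.closedBall 0 (max R R')})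
    (f := fun s => ∫ r in (0 : ℝ)..s, F (y r.toNNReal))
    (g := fun s => ∫ r in (0 : ℝ)..s, F (z r.toNNReal))
    (fun s _ => LipschitzOnWith.of_dist_le_mul fun x hx x' hx' => by
      simpa using hK.dist_le_mul _ hx _ hx')
    (intervalIntegral.continuous_primitive (fun _ _ =>
      (hF.comp (hy.comp continuous_real_toNNReal)).intervalIntegrable _ _) 0).continuousOn
    (fun s hs => (hprim hy ey s hs.1).2.hasDerivWithinAt)
    (fun s hs => by
      have := hR _ (hmem s hs)
      rw [(hprim hy ey s hs.1).1] at this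
      simpa using Or.inl this)
    (intervalIntegral.continuous_primitive (fun _ _ =>
      (hF.comp (hz.comp continuous_real_toNNReal)).intervalIntegrable _ _) 0).continuousOn
    (fun s hs => (hprim hz ez s hs.1).2.hasDerivWithinAt)
    (fun s hs => by
      have := hR' _ (hmem s hs)
      rw [(hprim hz ez s hs.1).1] at this
      simpa using Or.inr this)
    (by simp)
  rw [ey, ez]
  exact congrArg _ (hEq ⟨t.2, le_rfl⟩)

theorem stronglyMeasurable_integral_toNNReal {Ω : Type*} [MeasurableSpace Ω]
    {Y : ℝ≥0 → Ω → E} {t : ℝ≥0} (hY : ∀ s ≤ t, StronglyMeasurable (Y s))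
    (hc : ∀ ω, Continuous fun s => Y s ω) :
    StronglyMeasurable fun ω => ∫ s in (0 : ℝ)..t, Y s.toNNReal ω := by
  -- Freezing the process after time `t` makes every value measurable for the σ-algebra at time `t`;
  -- continuity in time then gives joint measurability.
  have h := stronglyMeasurable_uncurry_of_continuous_of_stronglyMeasurable
    (u := fun (s : ℝ) ω => Y (min s.toNNReal t) ω)
    (fun ω => (hc ω).comp (by fun_prop)) (fun s => hY _ (min_le_right _ _))
  have e : (fun ω => ∫ s in (0 : ℝ)..t, Y s.toNNReal ω) =
      fun ω => ∫ s in Ioc (0 : ℝ) t, Y (min s.toNNReal t) ω := by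
    ext ω
    rw [intervalIntegral.integral_of_le t.coe_nonneg]
    refine setIntegral_congr_fun measurableSet_Ioc fun s hs => ?_
    rw [min_eq_left (Real.toNNReal_le_iff_le_coe.2 hs.2)]
  rw [e]
  exact h.integral_prod_left

theorem stronglyAdapted_picardIterate {Ω : Type*} {mΩ : MeasurableSpace Ω}
    {𝓕 : Filtration ℝ≥0 mΩ} {w : ℝ≥0 → Ω → E} (hF : Continuous F)
    (hw : StronglyAdapted 𝓕 w) (hc : ∀ ω, Continuous fun t => w t ω) (k : ℕ) :
    StronglyAdapted 𝓕 fun t ω => picardIterate F (fun s => w s ω) k t := by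
  induction k with
  | zero => exact hw
  | succ k ih =>
    intro t
    refine (hw t).add (@stronglyMeasurable_integral_toNNReal E _ _ Ω (𝓕 t)
      (fun s ω => F (picardIterate F (fun s => w s ω) k s)) t (fun s hs => ?_) fun ω => ?_)
    · exact hF.comp_stronglyMeasurable ((ih s).mono (𝓕.mono hs))
    · exact hF.comp (continuous_picardIterate hF (hc ω) k)

end IntegralEquation

end SelfRepelling

namespace SelfRepelling

/-! ### Second moment of the running maximum of Brownian motion -/

section BrownianSup

open Set Filter Topology

/-- The point `j T / 2^k`. -/
noncomputable def dyadic (T : ℝ≥0) (k j : ℕ) : ℝ≥0 := j * T / 2 ^ k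

/-- Chaining: a point of level `k + 1` with even index already has level `k`, and one with odd index
is a single increment away from such a point. -/
theorem abs_dyadic_le {f : ℝ≥0 → ℝ} (h0 : f 0 = 0) {T : ℝ≥0} {b q : ℝ} (hb : 0 ≤ b) (hq : 0 ≤ q)
    (h : ∀ k, ∀ j < 2 ^ k, |f (dyadic T k (j + 1)) - f (dyadic T k j)| ≤ b * q ^ k) (k : ℕ) :
    ∀ j ≤ 2 ^ k, |f (dyadic T k j)| ≤ b * ∑ i ∈ Finset.range (k + 1), q ^ i := by
  induction k with
  | zero =>
    intro j hj
    have := h 0 0 (by simp)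
    rcases Nat.le_one_iff_eq_zero_or_eq_one.1 hj with rfl | rfl
    · simpa [dyadic, h0] using hb
    · simpa [dyadic, h0] using this
  | succ k ih =>
    intro j hj
    have heven : ∀ m, dyadic T (k + 1) (2 * m) = dyadic T k m := fun m => by
      simp only [dyadic]; push_cast; field_simp; ring
    rw [Finset.sum_range_succ, mul_add]
    rcases Nat.even_or_odd' j with ⟨m, rfl | rfl⟩
    · rw [heven]
      have := ih m (by rw [pow_succ] at hj; omega)
      have := mul_nonneg hb (pow_nonneg hq (k + 1))
      linarith
    · have h1 := ih m (by rw [pow_succ] at hj; omega)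
      have h2 := h (k + 1) (2 * m) (by omega)
      rw [← heven] at h1
      have := abs_add_le (f (dyadic T (k + 1) (2 * m + 1)) - f (dyadic T (k + 1) (2 * m)))
        (f (dyadic T (k + 1) (2 * m)))
      rw [sub_add_cancel] at this
      linarith

theorem tendsto_dyadic_floor {t T : ℝ≥0} (ht : t ≤ T) :
    Tendsto (fun k : ℕ => dyadic T k ⌊(t / T : ℝ) * 2 ^ k⌋₊) atTop (𝓝 t) := by
  rcases eq_or_ne T 0 with rfl | hT
  · obtain rfl : t = 0 := le_antisymm ht zero_le
    simp [dyadic]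
  have h1 := (tendsto_nat_floor_mul_div_atTop (R := ℝ) (a := t / T) (by positivity)).comp
    (tendsto_pow_atTop_atTop_of_one_lt (r := (2 : ℝ)) one_lt_two)
  have h2 := h1.mul_const (T : ℝ)
  rw [div_mul_cancel₀ _ (NNReal.coe_ne_zero.2 hT)] at h2
  rw [← NNReal.tendsto_coe]
  refine h2.congr fun k => ?_
  simp only [Function.comp, dyadic]
  push_cast
  ring

theorem abs_le_of_dyadic_increments {f : ℝ≥0 → ℝ} (hf : Continuous f) (h0 : f 0 = 0) {T : ℝ≥0}
    {b q : ℝ} (hb : 0 ≤ b) (hq : 0 ≤ q) (hq1 : q < 1)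
    (h : ∀ k, ∀ j < 2 ^ k, |f (dyadic T k (j + 1)) - f (dyadic T k j)| ≤ b * q ^ k)
    {t : ℝ≥0} (ht : t ≤ T) : |f t| ≤ b * (1 - q)⁻¹ := by
  refine le_of_tendsto ((hf.abs.tendsto t).comp (tendsto_dyadic_floor ht))
    (Eventually.of_forall fun k => ?_)
  refine (abs_dyadic_le h0 hb hq h k _ ?_).trans (mul_le_mul_of_nonneg_left ?_ hb)
  · refine Nat.floor_le_of_le ?_
    push_cast
    exact mul_le_of_le_one_left (by positivity)
      (div_le_one_of_le₀ (NNReal.coe_le_coe.2 ht) T.coe_nonneg)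
  · rw [← tsum_geometric_of_lt_one hq hq1]
    exact (summable_geometric_of_lt_one hq hq1).sum_le_tsum _ fun i _ => pow_nonneg hq i

/-- The fourth moment of the standard Gaussian law. -/
noncomputable def gaussianFourthMoment : ℝ≥0∞ := ∫⁻ x, ‖x‖ₑ ^ 4 ∂(gaussianReal 0 1)

theorem gaussianFourthMoment_lt_top : gaussianFourthMoment < ⊤ := by
  have h := (memLp_id_gaussianReal (μ := 0) (v := 1) 4).eLpNorm_lt_top
  have := lintegral_rpow_enorm_lt_top_of_eLpNorm_lt_top (by norm_num) (by norm_num) h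
  simpa [gaussianFourthMoment] using this

theorem lintegral_enorm_pow_four_gaussianReal (v : ℝ≥0) :
    ∫⁻ x, ‖x‖ₑ ^ 4 ∂(gaussianReal 0 v) = (v : ℝ≥0∞) ^ 2 * gaussianFourthMoment := by
  have e : gaussianReal 0 v = (gaussianReal 0 1).map ((NNReal.sqrt v : ℝ) * ·) := by
    rw [gaussianReal_map_const_mul]
    congr 1
    · simp
    · ext; simp
  rw [e, lintegral_map (by fun_prop) (by fun_prop), gaussianFourthMoment,
    ← lintegral_const_mul _ (by fun_prop)]
  refine lintegral_congr fun x => ?_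
  rw [enorm_mul, mul_pow]
  congr 1
  have : ‖((NNReal.sqrt v : ℝ≥0) : ℝ)‖ₑ = (NNReal.sqrt v : ℝ≥0∞) := by
    rw [Real.enorm_eq_ofReal (NNReal.coe_nonneg _), ENNReal.ofReal_coe_nnreal]
  rw [this, show (4 : ℕ) = 2 * 2 from rfl, pow_mul]
  norm_cast
  rw [NNReal.sq_sqrt]

variable {Ω : Type*} {mΩ : MeasurableSpace Ω} {μ : Measure Ω} {B : ℝ≥0 → Ω → ℝ}

/-- A weighted sum of the fourth powers of the dyadic increments. -/
noncomputable def dyadicSum (B : ℝ≥0 → Ω → ℝ) (T : ℝ≥0) (ω : Ω) : ℝ≥0∞ :=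
  ∑' k : ℕ, ∑ j ∈ Finset.range (2 ^ k),
    ENNReal.ofReal ((9 / 10)⁻¹ ^ k) ^ 4 * ‖B (dyadic T k (j + 1)) ω - B (dyadic T k j) ω‖ₑ ^ 4

/-- Level `k` has `2 ^ k` increments with fourth moment of order `4⁻ᵏ`. With the weights the levels
form a geometric series of ratio `(10 / 9) ^ 4 / 2 < 1`. Second moments would not do, since `2 ^ k *
2⁻ᵏ` does not decay. -/
theorem lintegral_dyadicSum_lt_top (hB : IsPreBrownianReal B μ) (T : ℝ≥0) :
    ∫⁻ ω, dyadicSum B T ω ∂μ < ⊤ := by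
  have hm : ∀ s t, AEMeasurable (fun ω => ‖B s ω - B t ω‖ₑ ^ 4) μ := fun s t =>
    ((hB.aemeasurable s).sub (hB.aemeasurable t)).enorm.pow_const 4
  have hinc : ∀ k j : ℕ, ∫⁻ ω, ‖B (dyadic T k (j + 1)) ω - B (dyadic T k j) ω‖ₑ ^ 4 ∂μ =
      ((T / 2 ^ k : ℝ≥0) : ℝ≥0∞) ^ 2 * gaussianFourthMoment := fun k j => by
    rw [← lintegral_enorm_pow_four_gaussianReal]
    have hd : nndist (dyadic T k (j + 1)).1 (dyadic T k j).1 = T / 2 ^ k := by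
      ext
      rw [coe_nndist, Real.dist_eq]
      simp only [dyadic, NNReal.val_eq_coe]
      push_cast
      rw [← sub_div, add_mul, add_sub_cancel_left, one_mul, abs_of_nonneg (by positivity)]
    have h := hB.hasLaw_sub (dyadic T k (j + 1)) (dyadic T k j)
    rw [hd] at h
    rw [← h.map_eq, lintegral_map' (by fun_prop) h.aemeasurable]
    rfl
  unfold dyadicSum
  rw [lintegral_tsum fun k => Finset.aemeasurable_fun_sum _ fun j _ => (hm _ _).const_mul _]
  have e : ∀ k : ℕ, ∫⁻ ω, ∑ j ∈ Finset.range (2 ^ k), ENNReal.ofReal ((9 / 10)⁻¹ ^ k) ^ 4 *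
      ‖B (dyadic T k (j + 1)) ω - B (dyadic T k j) ω‖ₑ ^ 4 ∂μ =
      ENNReal.ofReal (((10 / 9) ^ 4 / 2) ^ k * T ^ 2) * gaussianFourthMoment := fun k => by
    rw [lintegral_finsetSum' _ fun j _ => (hm _ _).const_mul _]
    simp_rw [lintegral_const_mul'' _ (hm _ _), hinc]
    rw [Finset.sum_const, Finset.card_range, nsmul_eq_mul, ← mul_assoc, ← mul_assoc]
    congr 1
    rw [← ENNReal.ofReal_coe_nnreal, ← ENNReal.ofReal_pow (by positivity),
      ← ENNReal.ofReal_pow (by positivity), ← ENNReal.ofReal_natCast,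
      ← ENNReal.ofReal_mul (by positivity), ← ENNReal.ofReal_mul (by positivity)]
    congr 1
    push_cast
    rw [div_pow ((10 / 9 : ℝ) ^ 4), ← pow_mul, ← pow_mul, mul_comm 4 k, inv_div]
    field_simp
  simp_rw [e]
  rw [ENNReal.tsum_mul_right]
  refine ENNReal.mul_lt_top ?_ gaussianFourthMoment_lt_top
  rw [← ENNReal.ofReal_tsum_of_nonneg (fun k => by positivity)]
  · exact ENNReal.ofReal_lt_top
  · exact (summable_geometric_of_lt_one (by norm_num) (by norm_num)).mul_right _

theorem aemeasurable_dyadicSum (hB : IsPreBrownianReal B μ) (T : ℝ≥0) :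
    AEMeasurable (dyadicSum B T) μ :=
  AEMeasurable.tsum fun _ => Finset.aemeasurable_fun_sum _ fun _ _ =>
    ((((hB.aemeasurable _).sub (hB.aemeasurable _)).enorm).pow_const 4).const_mul _

/-- Each weighted increment is at most the whole sum, so increments of level `k` are bounded by its
fourth root times `(9 / 10) ^ k`. Chaining gives the factor `(1 - 9 / 10)⁻¹ = 10`. -/
theorem enorm_pow_four_le_dyadicSum {T : ℝ≥0} {ω : Ω} (hc : Continuous fun t => B t ω)
    (h0 : B 0 ω = 0) {t : ℝ≥0} (ht : t ≤ T) :
    ‖B t ω‖ₑ ^ 4 ≤ ENNReal.ofReal (10 ^ 4) * dyadicSum B T ω := by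
  rcases eq_or_ne (dyadicSum B T ω) ⊤ with hZ | hZ
  · rw [hZ, ENNReal.mul_top (by simp)]; exact le_top
  set z := (dyadicSum B T ω).toReal with hz
  have hz0 : 0 ≤ z := ENNReal.toReal_nonneg
  have hroot : (z ^ (1 / 4 : ℝ)) ^ 4 = z := by
    rw [← Real.rpow_natCast, ← Real.rpow_mul hz0]; norm_num
  have hr0 : 0 ≤ z ^ (1 / 4 : ℝ) := Real.rpow_nonneg hz0 _
  have key : |B t ω| ≤ z ^ (1 / 4 : ℝ) * (1 - 9 / 10)⁻¹ := by
    refine abs_le_of_dyadic_increments hc h0 hr0 (by norm_num) (by norm_num)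
      (fun k j hj => ?_) ht
    have h1 : ENNReal.ofReal ((9 / 10)⁻¹ ^ k) ^ 4 *
        ‖B (dyadic T k (j + 1)) ω - B (dyadic T k j) ω‖ₑ ^ 4 ≤ ENNReal.ofReal z := by
      rw [hz, ENNReal.ofReal_toReal hZ]
      refine le_trans ?_ (ENNReal.le_tsum k)
      exact Finset.single_le_sum (f := fun j => ENNReal.ofReal ((9 / 10)⁻¹ ^ k) ^ 4 *
        ‖B (dyadic T k (j + 1)) ω - B (dyadic T k j) ω‖ₑ ^ 4) (fun _ _ => zero_le)
        (Finset.mem_range.2 hj)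
    rw [← mul_pow, Real.enorm_eq_ofReal_abs, ← ENNReal.ofReal_mul (by positivity),
      ← ENNReal.ofReal_pow (by positivity), ENNReal.ofReal_le_ofReal_iff hz0, ← hroot] at h1
    have h2 := le_of_pow_le_pow_left₀ (by norm_num) hr0 h1
    rwa [inv_pow, inv_mul_le_iff₀ (by positivity), mul_comm] at h2
  rw [← ENNReal.ofReal_toReal hZ, ← hz, ← ENNReal.ofReal_mul (by positivity),
    Real.enorm_eq_ofReal_abs, ← ENNReal.ofReal_pow (by positivity)]
  refine ENNReal.ofReal_le_ofReal ?_
  calc |B t ω| ^ 4 ≤ (z ^ (1 / 4 : ℝ) * (1 - 9 / 10)⁻¹) ^ 4 :=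
        pow_le_pow_left₀ (abs_nonneg _) key 4
    _ = 10 ^ 4 * z := by rw [mul_pow, hroot]; norm_num; ring

/-- The running maximum of a Brownian motion has a finite second moment: its square is dominated by
an integrable function. -/
theorem exists_dominating_of_isBrownianReal [IsProbabilityMeasure μ] (hB : IsBrownianReal B μ)
    (T : ℝ≥0) : ∃ Z : Ω → ℝ≥0∞, AEMeasurable Z μ ∧ ∫⁻ ω, Z ω ∂μ < ⊤ ∧
      ∀ᵐ ω ∂μ, ∀ t ≤ T, ‖B t ω‖ₑ ^ 2 ≤ Z ω := by
  have hB' := hB.toIsPreBrownianReal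
  -- The summand `1` passes from the fourth power to the square: `r ^ 2 ≤ 1 + r ^ 4`.
  refine ⟨fun ω => 1 + ENNReal.ofReal (10 ^ 4) * dyadicSum B T ω,
    ((aemeasurable_dyadicSum hB' T).const_mul _).const_add 1, ?_, ?_⟩
  · rw [lintegral_add_left measurable_const, lintegral_const_mul' _ _ ENNReal.ofReal_ne_top]
    exact ENNReal.add_lt_top.2 ⟨by simp,
      ENNReal.mul_lt_top ENNReal.ofReal_lt_top (lintegral_dyadicSum_lt_top hB' T)⟩
  · filter_upwards [hB.cont, hB'.eval_zero_ae_eq_zero] with ω hc h0 t ht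
    refine le_trans ?_ (add_le_add_right (enorm_pow_four_le_dyadicSum hc h0 ht) 1)
    rcases le_total (‖B t ω‖ₑ) 1 with h | h
    · exact le_add_right (pow_le_one₀ zero_le h)
    · exact le_add_left (pow_le_pow_right₀ h (by norm_num))

end BrownianSup

end SelfRepelling

namespace SelfRepelling

/-! ### Existence, uniqueness and the moment bound for the equation -/

section StrongSolution

open Set Filter Topology

variable {a : ℕ+ → ℝ} {ha : a ∈ rapidlyDecreasing 5}

theorem exists_lipschitzOnWith_drift_closedBall (R : ℝ) : ∃ K : ℝ≥0,
    LipschitzOnWith K (drift a ha) (Metric.closedBall 0 R) := by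
  obtain ⟨K, hK⟩ := exists_lipschitzOnWith_drift (ha := ha) R
  exact ⟨K, hK.mono fun y hy => (norm_snd_le y).trans (mem_closedBall_zero_iff.1 hy)⟩

theorem continuous_drift : Continuous (drift a ha) := by
  rw [continuous_iff_continuousAt]
  intro y
  obtain ⟨K, hK⟩ := exists_lipschitzOnWith_drift_closedBall (ha := ha) (‖y‖ + 1)
  exact hK.continuousOn.continuousAt (mem_of_superset (Metric.ball_mem_nhds y one_pos)
    fun z hz => mem_closedBall_zero_iff.2 (by
      have := norm_le_norm_add_norm_sub' z y
      rw [Metric.mem_ball, dist_eq_norm] at hz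
      linarith))

/-- The projection `(x, u, v) ↦ (u, v)`. -/
noncomputable def sndL : StateSpace →L[ℝ] WithLp 2 (SeqL2 × SeqL2) :=
  WithLp.sndL 2 ℝ ℝ (WithLp 2 (SeqL2 × SeqL2))

theorem sndL_e₀ : sndL e₀ = 0 := rfl

theorem norm_e₀ : ‖e₀‖ = 1 := by
  rw [e₀, WithLp.prod_norm_eq_of_L2]; simp

variable {Ω : Type*} {mΩ : MeasurableSpace Ω} {μ : Measure Ω} {𝓕 : Filtration ℝ≥0 mΩ}
  {W : ℝ≥0 → StateSpace → Ω → ℝ}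

/-- Setting the process to zero on the null set of discontinuous paths keeps it adapted, because
that set lies in `𝓕 0`. The integral equation can then be solved for every `ω`. -/
theorem exists_continuous_stronglyAdapted (h𝓕 : ∀ N : Set Ω, μ N = 0 → MeasurableSet[𝓕 0] N)
    {B : ℝ≥0 → Ω → ℝ} (hB : Adapted 𝓕 B) (hc : ∀ᵐ ω ∂μ, Continuous fun t => B t ω) :
    ∃ B' : ℝ≥0 → Ω → ℝ, StronglyAdapted 𝓕 B' ∧ (∀ ω, Continuous fun t => B' t ω) ∧
      ∀ᵐ ω ∂μ, ∀ t, B' t ω = B t ω := by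
  classical
  set N := {ω | ¬ Continuous fun t => B t ω}
  have hN0 : MeasurableSet[𝓕 0] N := h𝓕 N hc
  refine ⟨fun t => N.piecewise 0 (B t), fun t => ?_, fun ω => ?_, ?_⟩
  · exact (Measurable.piecewise (m := 𝓕 t) (𝓕.mono zero_le _ hN0) measurable_const
      (hB t)).stronglyMeasurable
  · by_cases h : ω ∈ N
    · simpa [h] using continuous_const
    · simpa [h] using not_not.1 h
  · filter_upwards [hc] with ω hω t
    exact piecewise_eq_of_notMem _ _ _ (not_not.2 hω)

theorem ae_eq_of_isStrongSolution {y : StateSpace} {Y Y' : ℝ≥0 → Ω → StateSpace}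
    (hY : IsStrongSolution 𝓕 μ (drift a ha) W y Y)
    (hY' : IsStrongSolution 𝓕 μ (drift a ha) W y Y') : ∀ᵐ ω ∂μ, ∀ t, Y' t ω = Y t ω := by
  filter_upwards [hY.continuous, hY'.continuous, hY.equation, hY'.equation] with ω c c' e e' t
  refine eq_of_integral_equation (w := fun t => y + sigmaW W t ω) (continuous_drift (ha := ha))
    exists_lipschitzOnWith_drift_closedBall c' c (fun t => ?_) (fun t => ?_) t
  · rw [e', add_right_comm]
  · rw [e, add_right_comm]

theorem exists_isStrongSolution (h𝓕 : ∀ N : Set Ω, μ N = 0 → MeasurableSet[𝓕 0] N)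
    (hW : IsCylindricalWiener 𝓕 μ W) (y : StateSpace) :
    ∃ Y : ℝ≥0 → Ω → StateSpace, IsStrongSolution 𝓕 μ (drift a ha) W y Y := by
  obtain ⟨B, hB, hBc, hBW⟩ := exists_continuous_stronglyAdapted h𝓕 (hW.adapted e₀)
    (hW.brownian e₀ norm_e₀).cont
  set w : ℝ≥0 → Ω → StateSpace := fun t ω => y + B t ω • e₀ with hw
  have hwc : ∀ ω, Continuous fun t => w t ω := fun ω =>
    continuous_const.add ((hBc ω).smul continuous_const)
  have hwa : StronglyAdapted 𝓕 w := fun t =>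
    stronglyMeasurable_const.add ((hB t).smul_const e₀)
  have hex := fun ω => exists_tendsto_picardIterate (F := drift a ha) (p := sndL)
    (A := 2 * ‖sqWeightedSeq a ha‖) (w := fun t => w t ω) (c := sndL y) continuous_drift
    exists_lipschitzOnWith_drift norm_drift_snd_le (hwc ω) (fun t => by
      rw [hw, map_add, map_smul, sndL_e₀, smul_zero, add_zero])
  -- Choosing path by path loses no measurability: `hYt` identifies the choice as the pointwise
  -- limit of the adapted iterates.
  choose Y hYc hYt hYe using hex
  refine ⟨fun t ω => Y ω t, ?_, ae_of_all _ hYc, ae_of_all _ fun ω K hK _ => ?_,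
    ae_of_all _ fun ω t => ?_, ?_⟩
  · intro t
    exact stronglyMeasurable_of_tendsto atTop
      (fun k => stronglyAdapted_picardIterate continuous_drift hwa hwc k t)
      (tendsto_pi_nhds.2 fun ω => hYt ω t)
  · have hc : Continuous fun s : ℝ => Y ω s.toNNReal := (hYc ω).comp continuous_real_toNNReal
    obtain ⟨C, hC⟩ := hK.exists_bound_of_continuousOn hc.continuousOn
    exact memLp_top_of_bound hc.aestronglyMeasurable C
      ((ae_restrict_iff' hK.measurableSet).2 (ae_of_all _ hC))
  · exact (continuous_drift.comp ((hYc ω).comp continuous_real_toNNReal)).intervalIntegrable _ _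
  · filter_upwards [hBW] with ω hω t
    rw [hYe, sigmaW, ← hω t, hw, add_right_comm]

/-- Domination by an a.e. measurable integrable function suffices, so measurability of the supremum
itself is not needed. -/
theorem lintegral_iSup_enorm_sq_lt_top [IsProbabilityMeasure μ]
    (hW : IsCylindricalWiener 𝓕 μ W) {y : StateSpace} {Y : ℝ≥0 → Ω → StateSpace}
    (hY : IsStrongSolution 𝓕 μ (drift a ha) W y Y) (T : ℝ≥0) :
    ∫⁻ ω, ⨆ t ∈ Icc 0 T, ‖Y t ω‖ₑ ^ 2 ∂μ < ⊤ := by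
  obtain ⟨Z, hZ, hZlt, hZle⟩ :=
    exists_dominating_of_isBrownianReal (hW.brownian e₀ norm_e₀) T
  set A := 2 * ‖sqWeightedSeq a ha‖
  have hA0 : 0 ≤ A := by positivity
  -- The initial norm plus `T` times the bound of `norm_drift_le`, with `‖(u, v)‖ ≤ ‖sndL y‖ + A *
  -- T` on `[0, T]`.
  set D := ‖y‖ + A * (1 + (‖sndL y‖ + A * T)) * T
  have hD0 : 0 ≤ D := by positivity
  have hbound : ∀ᵐ ω ∂μ, ⨆ t ∈ Icc 0 T, ‖Y t ω‖ₑ ^ 2 ≤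
      ENNReal.ofReal (2 * D ^ 2) + 2 * Z ω := by
    have h0 := (hW.brownian e₀ norm_e₀).toIsPreBrownianReal.eval_zero_ae_eq_zero
    filter_upwards [hZle, hY.continuous, hY.equation] with ω hz hc he
    have hsnd : ∀ t ≤ T, ‖(Y t ω).snd‖ ≤ ‖sndL y‖ + A * T := fun t ht => by
      have := norm_map_add_integral_le (p := sndL) (w := fun t => y + sigmaW W t ω)
        (c := sndL y) (continuous_drift (ha := ha)) hc norm_drift_snd_le
        (fun t => by rw [sigmaW, map_add, map_smul, sndL_e₀, smul_zero, add_zero]) t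
      rw [add_right_comm, ← he] at this
      exact this.trans (by gcongr)
    refine iSup₂_le fun t ht => ?_
    have h1 : ‖Y t ω‖ ≤ D + ‖W t e₀ ω‖ := by
      rw [he]
      refine (norm_add_le _ _).trans (add_le_add ((norm_add_le _ _).trans ?_) ?_)
      · refine add_le_add le_rfl ((norm_integral_toNNReal_le (f := fun s => drift a ha (Y s ω))
          (C := A * (1 + (‖sndL y‖ + A * T))) fun s hs => (norm_drift_le _).trans ?_).trans ?_)
        · gcongr
          exact hsnd s (hs.trans ht.2)
        · gcongr
          exact ht.2
      · rw [sigmaW, norm_smul, norm_e₀, mul_one]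
    have h2 : ‖Y t ω‖ ^ 2 ≤ 2 * D ^ 2 + 2 * ‖W t e₀ ω‖ ^ 2 := by
      nlinarith [pow_le_pow_left₀ (norm_nonneg _) h1 2, sq_nonneg (D - ‖W t e₀ ω‖)]
    calc ‖Y t ω‖ₑ ^ 2 = ENNReal.ofReal (‖Y t ω‖ ^ 2) := by
          rw [ENNReal.ofReal_pow (norm_nonneg _), ofReal_norm]
      _ ≤ ENNReal.ofReal (2 * D ^ 2 + 2 * ‖W t e₀ ω‖ ^ 2) := ENNReal.ofReal_le_ofReal h2
      _ = ENNReal.ofReal (2 * D ^ 2) + 2 * ‖W t e₀ ω‖ₑ ^ 2 := by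
          rw [ENNReal.ofReal_add (by positivity) (by positivity), ENNReal.ofReal_mul zero_le_two,
            ENNReal.ofReal_mul zero_le_two, ENNReal.ofReal_pow (norm_nonneg _),
            ofReal_norm, ENNReal.ofReal_ofNat]
      _ ≤ _ := by gcongr; exact hz t ht.2
  refine (lintegral_mono_ae hbound).trans_lt ?_
  rw [lintegral_add_left measurable_const, lintegral_const_mul'' _ hZ, lintegral_const,
    measure_univ, mul_one]
  exact ENNReal.add_lt_top.2 ⟨ENNReal.ofReal_lt_top, ENNReal.mul_lt_top (by simp) hZlt⟩

end StrongSolution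

end SelfRepelling

theorem mainTheorem1 {Ω : Type*} {mΩ : MeasurableSpace Ω} (μ : Measure Ω)
    [IsProbabilityMeasure μ] (𝓕 : Filtration ℝ≥0 mΩ)
    (h𝓕 : ∀ N : Set Ω, μ N = 0 → MeasurableSet[𝓕 0] N)
    (W : ℝ≥0 → SelfRepelling.StateSpace → Ω → ℝ)
    (hW : SelfRepelling.IsCylindricalWiener 𝓕 μ W)
    (a : ℕ+ → ℝ) (ha_pos : ∀ n, 0 < a n) (ha : a ∈ SelfRepelling.rapidlyDecreasing 5) :
    (∀ R : ℝ, ∃ K : ℝ≥0,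
      LipschitzOnWith K (SelfRepelling.drift a ha) (Metric.closedBall 0 R)) ∧
    ∀ y : SelfRepelling.StateSpace, ∃ Y : ℝ≥0 → Ω → SelfRepelling.StateSpace,
      SelfRepelling.IsStrongSolution 𝓕 μ (SelfRepelling.drift a ha) W y Y ∧
      (∀ Y' : ℝ≥0 → Ω → SelfRepelling.StateSpace,
        SelfRepelling.IsStrongSolution 𝓕 μ (SelfRepelling.drift a ha) W y Y' →
          ∀ᵐ ω ∂μ, ∀ t, Y' t ω = Y t ω) ∧
      ∀ T : ℝ≥0, ∫⁻ ω, ⨆ t ∈ Set.Icc 0 T, ‖Y t ω‖ₑ ^ 2 ∂μ < ⊤ := by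
  refine ⟨SelfRepelling.exists_lipschitzOnWith_drift_closedBall, fun y => ?_⟩
  obtain ⟨Y, hY⟩ := SelfRepelling.exists_isStrongSolution (ha := ha) h𝓕 hW y
  exact ⟨Y, hY, fun Y' hY' => SelfRepelling.ae_eq_of_isStrongSolution hY hY',
    fun T => SelfRepelling.lintegral_iSup_enorm_sq_lt_top hW hY T⟩
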